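/- \textbf{Conventions.} Let $(X,d)$ be a complete geodesic metric space (any two points are joined by a length-minimizing geodesic); write $|xy|=d(x,y)$. A constant-speed geodesic is a map $\xi:[0,1]\to X$ with $|\xi(s)\xi(t)|=|s-t|\,|\xi(0)\xi(1)|$ for all $s,t$. $X$ is \emph{$S$-concave} ($S\ge1$) if for all $p\in X$, all constant-speed geodesics $\xi$ and all $t\in[0,1]$, $$|p\xi(t)|^2\ge(1-t)|p\xi(0)|^2+t|p\xi(1)|^2-S\,t(1-t)|\xi(0)\xi(1)|^2 .$$ $X$ is \emph{$(C,D)$-locally semi-convex} ($C\ge0$, $D>0$) if for all $p\in X$ and all constant-speed geodesics $\xi$ with $\sup_{t\in[0,1]}|p\xi(t)|<D$, and all $t\in[0,1]$, $$|p\xi(t)|^2\le(1-t)|p\xi(0)|^2+t|p\xi(1)|^2+C\,t(1-t)|\xi(0)\xi(1)|^2 .$$ $X$ is \emph{Busemann concave} if for all constant-speed geodesics $\gamma,\eta$ with $\gamma(0)=\eta(0)$ the function $t\mapsto|\gamma(t)\eta(t)|/t$ is non-increasing on $(0,1]$. $X$ is \emph{$n$-dimensional} ($n\in\mathbb N$)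 if $\dim_H X=n$. For $p,q\neq x$ let $\tilde\angle pxq\in[0,\pi]$ be the angle at $\tilde x$ of the Euclidean comparison triangle with side lengths $|px|,|xq|,|pq|$. Let $X$ be $S$-concave and $(C,D)$-locally semi-convex, and let $0<\delta<1/2$. A point $p\ne x$ is a \emph{$(1,\delta)$-strainer at $x$ with opposite strainer $q\neq x$} if $$\tilde\angle pxq>\pi-\delta\quad\text{and}\quad \arccos\Bigl(1-\tfrac{S|qx|}{2|px|}\Bigr)<\delta .$$ (Here and below, an inequality $\arccos(a)<\delta$ includes the requirement that $a\ge-1$.) For $k\ge1$, a tuple $(p_1,\dots,p_k)$ is a \emph{$(k,\delta)$-strainer at $x$} if $|p_1x|<D$ and, inductively: (1) $(p_1,\dots,p_{k-1})$ is a $(k-1,\delta)$-strainer at $x$ (no condition if $k=1$); (2) $p_k$ is a $(1,\delta)$-strainer at $x$ and $\arccos\bigl(1-\frac{(S+C)|p_kx|}{2|p_ix|}\bigr)<\delta$ for all $i<k$; (3) there is an opposite strainer $q_k$ of the $(1,\delta)$-strainer $p_k$ at $x$ with $|\tilde\angle p_ixp_k-\frac\pi2|<\delta$ and $|\tilde\angle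 p_ixq_k-\frac\pi2|<\delta$ for all $i<k$. Let $\mathcal A(k,\delta)\subset X$ be the set of points at which there is a $(k,\delta)$-strainer (with respect to the given $S,C,D$). \textbf{Theorem.} For every $\delta\in(0,1/2)$ there is a constant $S_1=S_1(\delta)>1$ such that the following holds. Let $S\in[1,S_1]$, $C\ge0$, $D>0$, $n\in\mathbb N$, and let $X$ be an $n$-dimensional complete geodesic space that is $S$-concave, $(C,D)$-locally semi-convex and Busemann concave. Then $$\dim_H\bigl(X\setminus\mathcal A(k,\delta)\bigr)\le k-1\qquad\text{for all }k=1,\dots,n .$$ -/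

import Mathlib

open Set
open scoped ENNReal

namespace StrainerTheory

noncomputable section

/-- `ξ`, restricted to `[0,1]`, is a constant-speed (minimizing) geodesic from `ξ 0` to `ξ 1`. -/
def IsConstSpeedGeodesic {X : Type*} [MetricSpace X] (ξ : ℝ → X) : Prop :=
  ∀ s ∈ Icc (0 : ℝ) 1, ∀ t ∈ Icc (0 : ℝ) 1,
    dist (ξ s) (ξ t) = |s - t| * dist (ξ 0) (ξ 1)

/-- Any two points are joined by a geodesic. -/
def IsGeodesicSpace (X : Type*) [MetricSpace X] : Prop :=
  ∀ x y : X, ∃ ξ : ℝ → X, IsConstSpeedGeodesic ξ ∧ ξ 0 = x ∧ ξ 1 = y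

/-- `S`-concavity of the squared distance functions. -/
def IsSConcave (X : Type*) [MetricSpace X] (S : ℝ) : Prop :=
  ∀ (p : X) (ξ : ℝ → X), IsConstSpeedGeodesic ξ → ∀ t ∈ Icc (0 : ℝ) 1,
    (1 - t) * dist p (ξ 0) ^ 2 + t * dist p (ξ 1) ^ 2
      - S * t * (1 - t) * dist (ξ 0) (ξ 1) ^ 2 ≤ dist p (ξ t) ^ 2

/-- `(C, D)`-local semi-convexity. By compactness of `[0,1]`, the condition
`∀ s ∈ [0,1], |p ξ(s)| < D` is the same as `sup |p ξ(s)| < D`. -/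
def IsLocallySemiConvex (X : Type*) [MetricSpace X] (C D : ℝ) : Prop :=
  ∀ (p : X) (ξ : ℝ → X), IsConstSpeedGeodesic ξ →
    (∀ s ∈ Icc (0 : ℝ) 1, dist p (ξ s) < D) → ∀ t ∈ Icc (0 : ℝ) 1,
      dist p (ξ t) ^ 2 ≤ (1 - t) * dist p (ξ 0) ^ 2 + t * dist p (ξ 1) ^ 2
        + C * t * (1 - t) * dist (ξ 0) (ξ 1) ^ 2

/-- Busemann concavity: `t ↦ d(γ(t), η(t)) / t` is non-increasing for constant-speed geodesics
with a common starting point. -/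
def IsBusemannConcave (X : Type*) [MetricSpace X] : Prop :=
  ∀ γ η : ℝ → X, IsConstSpeedGeodesic γ → IsConstSpeedGeodesic η → γ 0 = η 0 →
    AntitoneOn (fun t : ℝ => dist (γ t) (η t) / t) (Ioc 0 1)

/-- The angle at `x` of the Euclidean comparison triangle of `p, x, q`, for `p ≠ x ≠ q`
(law of cosines). -/
def comparisonAngle {X : Type*} [MetricSpace X] (p x q : X) : ℝ :=
  Real.arccos ((dist p x ^ 2 + dist x q ^ 2 - dist p q ^ 2) / (2 * dist p x * dist x q))

/-- `q` is an opposite strainer of the `(1, δ)`-strainer `p` at `x`. -/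
def IsOppositeStrainer {X : Type*} [MetricSpace X] (S δ : ℝ) (x p q : X) : Prop :=
  p ≠ x ∧ q ≠ x ∧ Real.pi - δ < comparisonAngle p x q ∧
    Real.arccos (1 - S * (dist q x / (2 * dist p x))) < δ

/-- `p` is a `(1, δ)`-strainer at `x`. -/
def IsOneStrainer {X : Type*} [MetricSpace X] (S δ : ℝ) (x p : X) : Prop :=
  ∃ q : X, IsOppositeStrainer S δ x p q

/-- `p = (p 0, …, p (k-1))` is a `(k, δ)`-strainer at `x`, by recursion on `k`
(in an `S`-concave, `(C, D)`-locally semi-convex space). -/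
def IsStrainer {X : Type*} [MetricSpace X] (S C D δ : ℝ) (x : X) :
    (k : ℕ) → (Fin k → X) → Prop
  | 0, _ => True
  | k + 1, p =>
      dist (p 0) x < D ∧
      IsStrainer S C D δ x k (fun i => p i.castSucc) ∧
      IsOneStrainer S δ x (p (Fin.last k)) ∧
      (∀ i : Fin k, Real.arccos
        (1 - (S + C) * dist (p (Fin.last k)) x / (2 * dist (p i.castSucc) x)) < δ) ∧
      ∃ q : X, IsOppositeStrainer S δ x (p (Fin.last k)) q ∧
        ∀ i : Fin k,
          |comparisonAngle (p i.castSucc) x (p (Fin.last k)) - Real.pi / 2| < δ ∧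
          |comparisonAngle (p i.castSucc) x q - Real.pi / 2| < δ

/-- The set `𝒜(k, δ)` of `(k, δ)`-strained points. -/
def strainedPoints (X : Type*) [MetricSpace X] (S C D : ℝ) (k : ℕ) (δ : ℝ) : Set X :=
  {x | ∃ p : Fin k → X, IsStrainer S C D δ x k p}

end

end StrainerTheory

/-! Write A(j) for `strainedPoints X S C D j δ`. Since A(0) = X, the complement of A(k+1) is covered
by the layers A(j) \ A(j+1) with j ≤ k, so it suffices that each layer has dimension at most j.

Near a point with a j-strainer p, consider at each x finite sets of points at distance r from x,
pairwise εr-separated and almost orthogonal to every p_l (`HasOrthogonalPacking`). Busemann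
concavity lets such a set be contracted towards x without losing relative separation, so finite
dimension bounds its size uniformly (`exists_packing_bound`). Sort the points outside A(j+1) by this
maximal size m and by a scale at which it is attained.

On a small piece of one class, x ↦ (|p_l x|)_l ∈ ℝ^j expands distances up to a constant. Otherwise
two points x, x' of the piece are nearly orthogonal to p. Contract the packing at x to scale |xx'|
and add x'. The result is still separated: if x' were close to a contracted point, x' would lie
almost between x and an original packing point z, and (p, z) with opposite strainer x would be a
(j+1)-strainer at x' (`le_dist_of_notMem_strainedPoints`). Thus x has a packing of size m + 1,
contradicting maximality. -/

namespace StrainerTheory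

open Filter Topology
open scoped NNReal

/-! ### Packing bounds from finite Hausdorff dimension -/

/-- The centres of the balls along the branch `ω` of a tree of nested balls. -/
def branch {X ι : Type*} (c : ℕ → X → ι → X) (p : X) (ω : ℕ → ι) : ℕ → X
  | 0 => p
  | j + 1 => c j (branch c p ω j) (ω j)

theorem branch_congr {X ι : Type*} (c : ℕ → X → ι → X) (p : X) {ω ω' : ℕ → ι} {j : ℕ}
    (h : ∀ i < j, ω i = ω' i) : branch c p ω j = branch c p ω' j := by
  induction j with
  | zero => rfl
  | succ j ih =>
    simp only [branch]
    rw [ih fun i hi => h i (by omega), h j (by omega)]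

/-- Sending `L ω` to the real number with base-`M` digits `ω` is d-Hölder on the range and maps onto
`[0,1]`, which has dimension 1. -/
theorem dimH_lower_bound_of_separated_map {X : Type*} [MetricSpace X] {M d : ℕ} (hM : 1 < M)
    (hd : 0 < d) (L : (ℕ → Fin M) → X) {a b : ℝ} (ha : 0 < a) (hb : 0 < b)
    (hbM : 1 ≤ (M : ℝ) * b ^ d)
    (hL : ∀ ω ω' : ℕ → Fin M, ∀ j, (∀ i < j, ω i = ω' i) → ω j ≠ ω' j →
      a * b ^ j ≤ dist (L ω) (L ω')) :
    (d : ℝ≥0∞) ≤ dimH (range L) := by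
  classical
  have hM0 : (0 : ℝ) < M := by positivity
  have key : ∀ ω ω', |Real.ofDigits ω - Real.ofDigits ω'| ≤ (a⁻¹ * dist (L ω) (L ω')) ^ d := by
    intro ω ω'
    by_cases h : ω = ω'
    · subst h; simp [hd.ne']
    · have hne : ∃ j, ω j ≠ ω' j := by
        by_contra! h'
        exact h (funext h')
      have hlt : ∀ i < Nat.find hne, ω i = ω' i := fun i hi => by
        simpa using Nat.find_min hne hi
      refine (Real.abs_ofDigits_sub_ofDigits_le hlt).trans ?_
      have h1 := hL ω ω' _ hlt (Nat.find_spec hne)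
      set j := Nat.find hne
      have h2 : b ^ j ≤ a⁻¹ * dist (L ω) (L ω') := by
        rw [inv_mul_eq_div, le_div_iff₀ ha]; linarith
      calc ((M : ℝ) ^ j)⁻¹ ≤ (b ^ d) ^ j := by
            rw [inv_le_iff_one_le_mul₀ (by positivity), ← mul_pow, mul_comm]
            exact one_le_pow₀ hbM
        _ = (b ^ j) ^ d := by rw [← pow_mul, ← pow_mul, mul_comm]
        _ ≤ _ := by gcongr
  have hinj : Function.Injective L := by
    intro ω ω' h
    by_contra h'
    have hne : ∃ j, ω j ≠ ω' j := by
      by_contra! h''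
      exact h' (funext h'')
    have := hL ω ω' _ (fun i hi => by simpa using Nat.find_min hne hi) (Nat.find_spec hne)
    rw [h, dist_self] at this
    have : 0 < a * b ^ Nat.find hne := by positivity
    linarith
  have : Nonempty (ℕ → Fin M) := ⟨fun _ => ⟨0, by omega⟩⟩
  set F : X → ℝ := fun x => Real.ofDigits (Function.invFun L x)
  have hF : ∀ ω, F (L ω) = Real.ofDigits ω := fun ω => by
    simp only [F, Function.leftInverse_invFun hinj ω]
  have hHol : HolderOnWith (Real.toNNReal (a⁻¹ ^ d)) (d : ℝ≥0) F (range L) := by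
    rintro _ ⟨ω, rfl⟩ _ ⟨ω', rfl⟩
    rw [hF, hF, edist_dist, edist_dist, Real.dist_eq]
    refine (ENNReal.ofReal_le_ofReal (key ω ω')).trans (le_of_eq ?_)
    rw [mul_pow, ENNReal.ofReal_mul (by positivity), NNReal.coe_natCast, ENNReal.rpow_natCast,
      ENNReal.ofReal_pow dist_nonneg]
    rfl
  have h1 := hHol.dimH_image_le (by exact_mod_cast hd)
  have h2 : (1 : ℝ≥0∞) ≤ dimH (F '' range L) := by
    rw [← Real.dimH_segment (x := (0 : ℝ)) (y := 1) zero_ne_one]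
    apply dimH_mono
    rw [segment_eq_Icc zero_le_one]
    intro y hy
    obtain ⟨ω, -, rfl⟩ := Real.ofDigits_SurjOn hM hy
    exact ⟨L ω, ⟨ω, rfl⟩, hF ω⟩
  have h3 := h2.trans h1
  rw [ENNReal.le_div_iff_mul_le (by left; simp [hd.ne']) (by left; simp)] at h3
  simpa using h3

theorem dimH_lower_bound_of_packing {X : Type*} [MetricSpace X] [CompleteSpace X] {M d : ℕ}
    (hM : 1 < M) (hd : 0 < d) {ε : ℝ} (hε : 0 < ε) (hε1 : ε ≤ 1) (hεM : 1 ≤ (M : ℝ) * (ε / 16) ^ d)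
    (p : X) {R : ℝ} (hR : 0 < R)
    (h : ∀ x ∈ Metric.closedBall p R, ∀ r, 0 < r → r ≤ R → ∃ y : Fin M → X,
      (∀ i, dist x (y i) ≤ r) ∧ ∀ i j, i ≠ j → ε / 2 * r ≤ dist (y i) (y j)) :
    (d : ℝ≥0∞) ≤ dimH (univ : Set X) := by
  -- A limit lies within `2 * r (j+1) = ε/8 * r j` of its level-(j+1) centre, so limits branching at
  -- level `j` stay `ε/2 - 2 * ε/8 = ε/4` apart in units of `r j`.
  set l : ℝ := ε / 16 with hl
  have hl0 : 0 < l := by positivity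
  have hl1 : l ≤ 1 / 16 := by linarith
  set r : ℕ → ℝ := fun j => R / 2 * l ^ j with hr
  have hr0 : ∀ j, 0 < r j := fun j => by positivity
  have hrs : ∀ j, r (j + 1) = l * r j := fun j => by simp only [hr, pow_succ]; ring
  have hrR : ∀ j, r j ≤ R / 2 := fun j => by
    have : l ^ j ≤ 1 := pow_le_one₀ hl0.le (by linarith)
    simp only [hr]; nlinarith
  have h' : ∀ (j : ℕ) (x : X), ∃ y : Fin M → X, x ∈ Metric.closedBall p R →
      (∀ i, dist x (y i) ≤ r j) ∧ ∀ i i', i ≠ i' → ε / 2 * r j ≤ dist (y i) (y i') := by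
    intro j x
    by_cases hx : x ∈ Metric.closedBall p R
    · obtain ⟨y, hy⟩ := h x hx (r j) (hr0 j) (by linarith [hrR j])
      exact ⟨y, fun _ => hy⟩
    · exact ⟨fun _ => x, fun h => absurd h hx⟩
  choose c hc using h'
  -- The margin `2 * r j` absorbs all later steps and keeps the branch where the packing hypothesis
  -- applies.
  have hmem : ∀ ω j, dist (branch c p ω j) p ≤ R - 2 * r j := by
    intro ω j
    induction j with
    | zero =>
      simp only [branch, hr, dist_self, pow_zero]
      linarith
    | succ j ih =>
      have h1 := (hc j (branch c p ω j) (by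
        rw [Metric.mem_closedBall]; linarith [hr0 j])).1 (ω j)
      have h2 := dist_triangle_left (branch c p ω (j + 1)) p (branch c p ω j)
      have h3 : dist (branch c p ω j) (branch c p ω (j + 1)) ≤ r j := h1
      rw [hrs]
      nlinarith [hr0 j]
  have hball : ∀ ω j, branch c p ω j ∈ Metric.closedBall p R := fun ω j => by
    rw [Metric.mem_closedBall]; linarith [hmem ω j, hr0 j]
  have hstep : ∀ ω j, dist (branch c p ω j) (branch c p ω (j + 1)) ≤ R / 2 * l ^ j :=
    fun ω j => (hc j _ (hball ω j)).1 (ω j)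
  have hlim : ∀ ω, ∃ y, Tendsto (branch c p ω) atTop (𝓝 y) := fun ω =>
    cauchySeq_tendsto_of_complete
      (cauchySeq_of_le_geometric l (R / 2) (by linarith) (hstep ω))
  choose L hL using hlim
  have hdist : ∀ ω j, dist (branch c p ω j) (L ω) ≤ 2 * r j := by
    intro ω j
    refine (dist_le_of_le_geometric_of_tendsto l (R / 2) (by linarith) (hstep ω) (hL ω) j).trans ?_
    rw [div_le_iff₀ (by linarith)]
    have := hr0 j
    simp only [hr] at this ⊢
    nlinarith
  refine (dimH_lower_bound_of_separated_map hM hd L (a := ε / 4 * (R / 2)) (b := l)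
    (by positivity) hl0 hεM ?_).trans (dimH_mono (subset_univ _))
  intro ω ω' j hj hne
  have h1 : ε / 2 * r j ≤ dist (branch c p ω (j + 1)) (branch c p ω' (j + 1)) := by
    simp only [branch]
    rw [← branch_congr c p hj]
    exact (hc j _ (hball ω j)).2 _ _ hne
  have h2 := hdist ω (j + 1)
  have h3 := hdist ω' (j + 1)
  have h4 := dist_triangle4 (branch c p ω (j + 1)) (L ω) (L ω') (branch c p ω' (j + 1))
  rw [dist_comm (L ω')] at h4
  have h5 : l * r j = ε / 16 * r j := by rw [hl]
  rw [hrs] at h2 h3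
  have h6 : ε / 4 * (R / 2) * l ^ j = ε / 4 * r j := by simp only [hr]; ring
  rw [h6]
  linarith

theorem IsBusemannConcave.le_dist {X : Type*} [MetricSpace X] (hB : IsBusemannConcave X)
    {γ η : ℝ → X} (hγ : IsConstSpeedGeodesic γ) (hη : IsConstSpeedGeodesic η) (h0 : γ 0 = η 0)
    {t : ℝ} (ht : 0 < t) (ht1 : t ≤ 1) : t * dist (γ 1) (η 1) ≤ dist (γ t) (η t) := by
  have := hB γ η hγ hη h0 ⟨ht, ht1⟩ ⟨one_pos, le_rfl⟩ ht1
  simp only [div_one] at this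
  rw [le_div_iff₀ ht] at this
  linarith

/-- A large packing in one ball contracts along geodesics to a packing around every point of the
ball at every smaller scale, losing only a factor 2 in relative separation. The resulting tree would
have dimension at least `n + 1`. -/
theorem exists_packing_bound {X : Type*} [MetricSpace X] [CompleteSpace X]
    (hG : IsGeodesicSpace X) (hB : IsBusemannConcave X) {n : ℕ}
    (hn : dimH (univ : Set X) = (n : ℝ≥0∞)) {ε : ℝ} (hε : 0 < ε) (hε1 : ε ≤ 1) :
    ∃ M : ℕ, ∀ (p : X) (R : ℝ), 0 < R → ∀ y : Fin M → X, (∀ i, dist p (y i) ≤ R) →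
      ∃ i j, i ≠ j ∧ dist (y i) (y j) < ε * R := by
  obtain ⟨M₀, hM₀⟩ := exists_nat_ge (((ε / 16) ^ (n + 1))⁻¹)
  refine ⟨M₀ + 2, fun p R hR y hy => ?_⟩
  by_contra! hsep
  have hd : ((n + 1 : ℕ) : ℝ≥0∞) ≤ dimH (univ : Set X) := by
    refine dimH_lower_bound_of_packing (M := M₀ + 2) (by omega) (by omega) hε hε1 ?_ p hR ?_
    · rw [← inv_le_iff_one_le_mul₀ (by positivity)]
      push_cast; linarith
    · intro x hx r hr hrR
      have hxy : ∀ i, dist x (y i) ≤ 2 * R := fun i => by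
        have := dist_triangle x p (y i)
        have := hy i
        rw [Metric.mem_closedBall] at hx
        linarith
      choose γ hγ hγ0 hγ1 using fun i => hG x (y i)
      have ht : 0 < r / (2 * R) := by positivity
      have ht1 : r / (2 * R) ≤ 1 := by rw [div_le_one (by positivity)]; linarith
      refine ⟨fun i => γ i (r / (2 * R)), fun i => ?_, fun i j hij => ?_⟩
      · have := hγ i 0 (by simp) (r / (2 * R)) ⟨ht.le, ht1⟩
        rw [hγ0, hγ1, zero_sub, abs_neg, abs_of_pos ht] at this
        rw [this]
        calc r / (2 * R) * dist x (y i) ≤ r / (2 * R) * (2 * R) := by gcongr; exact hxy i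
          _ = r := by field_simp
      · have := hB.le_dist (hγ i) (hγ j) (by rw [hγ0, hγ0]) ht ht1
        rw [hγ1, hγ1] at this
        refine le_trans ?_ this
        calc ε / 2 * r = r / (2 * R) * (ε * R) := by field_simp
          _ ≤ _ := by gcongr; exact hsep i j hij
  rw [hn] at hd
  norm_cast at hd
  omega

/-- Packing bounds make balls totally bounded. Second countability is what allows Hausdorff
dimension to be detected locally. -/
theorem secondCountable_of_packing_bound {X : Type*} [MetricSpace X]
    (h : ∀ ε : ℝ, 0 < ε → ε ≤ 1 → ∃ M : ℕ, ∀ (p : X) (R : ℝ), 0 < R → ∀ y : Fin M → X,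
      (∀ i, dist p (y i) ≤ R) → ∃ i j, i ≠ j ∧ dist (y i) (y j) < ε * R) :
    SecondCountableTopology X := by
  classical
  rcases isEmpty_or_nonempty X with hX | ⟨⟨p⟩⟩
  · infer_instance
  refine Metric.secondCountable_of_almost_dense_set fun ε hε => ?_
  have hfin : ∀ N : ℕ, ∃ s : Finset X, ∀ x, dist p x ≤ N + 1 → ∃ y ∈ s, dist x y ≤ ε := by
    intro N
    have hN : (0 : ℝ) < N + 1 := by positivity
    obtain ⟨M, hM⟩ := h (min 1 (ε / (N + 1))) (by positivity) (min_le_left _ _)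
    by_contra! hcon
    have hbuild : ∀ m : ℕ, ∃ y : Fin m → X, (∀ i, dist p (y i) ≤ N + 1) ∧
        ∀ i j, i ≠ j → ε ≤ dist (y i) (y j) := by
      intro m
      induction m with
      | zero => exact ⟨fun i => i.elim0, fun i => i.elim0, fun i => i.elim0⟩
      | succ m ih =>
        obtain ⟨y, hy, hyy⟩ := ih
        obtain ⟨x, hx, hxy⟩ := hcon (Finset.univ.image y)
        have hxy' : ∀ i, ε < dist x (y i) := fun i => hxy _ (by simp)
        refine ⟨Fin.cons x y, fun i => ?_, fun i j => ?_⟩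
        · refine Fin.cases ?_ (fun i => ?_) i
          · simpa using hx
          · simpa using hy i
        · refine Fin.cases ?_ (fun i => ?_) i <;> refine Fin.cases ?_ (fun j => ?_) j
          · simp
          · intro _; simpa using (hxy' j).le
          · intro _; simpa [dist_comm] using (hxy' i).le
          · intro hij; simpa using hyy i j (by simpa using hij)
    obtain ⟨y, hy, hyy⟩ := hbuild M
    obtain ⟨i, j, hij, hlt⟩ := hM p (N + 1) hN y hy
    have h1 := hyy i j hij
    have h2 : min 1 (ε / (N + 1)) * ((N : ℝ) + 1) ≤ ε :=
      calc min 1 (ε / (N + 1)) * ((N : ℝ) + 1) ≤ ε / (N + 1) * (N + 1) := by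
            gcongr; exact min_le_right _ _
        _ = ε := by field_simp
    linarith
  choose s hs using hfin
  refine ⟨⋃ N, (s N : Set X), countable_iUnion fun N => (s N).countable_toSet, fun x => ?_⟩
  obtain ⟨N, hN⟩ := exists_nat_ge (dist p x)
  obtain ⟨y, hy, hxy⟩ := hs N x (by linarith)
  exact ⟨y, mem_iUnion.2 ⟨N, hy⟩, hxy⟩

/-! ### Expanding maps and arccosine estimates -/

theorem dimH_le_of_antilipschitzOn {X Y : Type*} [MetricSpace X] [MetricSpace Y] {s : Set X}
    {f : X → Y} {K : ℝ} (hK : 0 ≤ K) (h : ∀ x ∈ s, ∀ y ∈ s, dist x y ≤ K * dist (f x) (f y)) :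
    dimH s ≤ dimH (f '' s) := by
  have h1 : AntilipschitzWith K.toNNReal (fun x : s => f x) :=
    AntilipschitzWith.of_le_mul_dist fun x y => by
      rw [Real.coe_toNNReal K hK]
      exact h x x.2 y y.2
  have h2 := h1.le_dimH_image univ
  have h3 := (isometry_subtype_coe (s := s)).dimH_image univ
  rw [image_univ, Subtype.range_coe] at h3
  rw [h3]
  refine h2.trans (dimH_mono ?_)
  rintro _ ⟨x, -, rfl⟩
  exact ⟨x, x.2, rfl⟩

theorem arccos_lt_iff_cos_lt {δ y : ℝ} (h0 : 0 < δ) (hπ : δ ≤ Real.pi) :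
    Real.arccos y < δ ↔ Real.cos δ < y := by
  constructor
  · intro h
    by_contra! hy
    have := Real.antitone_arccos hy
    rw [Real.arccos_cos h0.le hπ] at this
    linarith
  · intro h
    rcases le_or_gt y 1 with hy | hy
    · rw [← Real.arccos_cos h0.le hπ]
      exact Real.arccos_lt_arccos (Real.neg_one_le_cos δ) h hy
    · rwa [Real.arccos_eq_zero.2 hy.le]

theorem abs_arccos_sub_pi_div_two_lt {δ v : ℝ} (h0 : 0 < δ) (hδ : δ < Real.pi / 2)
    (hv : |v| < Real.sin δ) : |Real.arccos v - Real.pi / 2| < δ := by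
  rw [abs_lt] at hv
  have h1 : Real.arcsin v < δ :=
    (Real.arcsin_lt_iff_lt_sin' ⟨by linarith, hδ.le⟩).2 hv.2
  have h2 : -δ < Real.arcsin v :=
    (Real.lt_arcsin_iff_sin_lt' ⟨by linarith, by linarith⟩).2 (by rw [Real.sin_neg]; exact hv.1)
  rw [Real.arccos_eq_pi_div_two_sub_arcsin, abs_lt]
  constructor <;> linarith

/-! ### Openness of the strainer conditions -/

section Open

variable {X : Type*} [MetricSpace X]

theorem continuousAt_comparisonAngle {p x q : X} (hp : p ≠ x) (hq : q ≠ x) :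
    ContinuousAt (fun y => comparisonAngle p y q) x := by
  unfold comparisonAngle
  refine Real.continuous_arccos.continuousAt.comp (ContinuousAt.div (by fun_prop) (by fun_prop) ?_)
  have h1 := dist_pos.2 hp
  have h2 := dist_pos.2 hq.symm
  positivity

theorem IsOppositeStrainer.eventually {S δ : ℝ} {x p q : X} (h : IsOppositeStrainer S δ x p q) :
    ∀ᶠ y in 𝓝 x, IsOppositeStrainer S δ y p q := by
  obtain ⟨hp, hq, h1, h2⟩ := h
  have hp0 := dist_pos.2 hp
  have hc : ContinuousAt (fun y => Real.arccos (1 - S * (dist q y / (2 * dist p y)))) x := by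
    refine Real.continuous_arccos.continuousAt.comp (continuousAt_const.sub
      (continuousAt_const.mul (ContinuousAt.div (by fun_prop) (by fun_prop) (by positivity))))
  filter_upwards [eventually_ne_nhds hp.symm, eventually_ne_nhds hq.symm,
    (continuousAt_comparisonAngle hp hq).eventually (lt_mem_nhds h1),
    hc.eventually (gt_mem_nhds h2)] with y h1 h2 h3 h4
  exact ⟨h1.symm, h2.symm, h3, h4⟩

theorem IsStrainer.ne {S C D δ : ℝ} {x : X} : ∀ {k : ℕ} {p : Fin k → X},
    IsStrainer S C D δ x k p → ∀ l, p l ≠ x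
  | 0, _, _, l => l.elim0
  | k + 1, p, h, l => by
    obtain ⟨-, h1, ⟨q, h2⟩, -⟩ := h
    refine Fin.lastCases h2.1 (fun l => h1.ne l) l

theorem IsStrainer.dist_lt {S C D δ : ℝ} (hS : 1 ≤ S) (hC : 0 ≤ C) (hδ : 0 < δ) (hδ' : δ < 1 / 2)
    {x : X} : ∀ {k : ℕ} {p : Fin k → X}, IsStrainer S C D δ x k p → ∀ l, dist (p l) x < D
  | 0, _, _, l => l.elim0
  | k + 1, p, h, l => by
    have hne := h.ne
    obtain ⟨h0, h1, -, h3, -⟩ := h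
    refine Fin.lastCases ?_ (fun l => h1.dist_lt hS hC hδ hδ' l) l
    match k, p, h0, h3, hne with
    | 0, p, h0, _, _ => exact h0
    | k + 1, p, h0, h3, hne =>
      refine lt_of_le_of_lt ?_ h0
      -- As `cos δ ≥ 1/2` and `S + C ≥ 1`, the smallness condition against `p 0` makes the last
      -- strainer nearer to `x` than `p 0`.
      have h4 := h3 0
      rw [arccos_lt_iff_cos_lt hδ (by linarith [Real.pi_gt_three])] at h4
      have h5 : (1 : ℝ) / 2 ≤ Real.cos δ := by
        have := Real.one_sub_sq_div_two_le_cos (x := δ)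
        nlinarith
      have h6 : 0 < dist (p 0) x := dist_pos.2 (hne 0)
      have h7 : (S + C) * dist (p (Fin.last (k + 1))) x / (2 * dist (p (Fin.castSucc 0)) x) < 1 / 2 := by
        linarith
      rw [Fin.castSucc_zero, div_lt_iff₀ (by positivity)] at h7
      have h8 : 0 ≤ dist (p (Fin.last (k + 1))) x := dist_nonneg
      nlinarith

theorem IsStrainer.eventually {S C D δ : ℝ} {x : X} : ∀ {k : ℕ} {p : Fin k → X},
    IsStrainer S C D δ x k p → ∀ᶠ y in 𝓝 x, IsStrainer S C D δ y k p
  | 0, _, _ => Eventually.of_forall fun _ => trivial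
  | k + 1, p, h => by
    have hne := h.ne
    obtain ⟨h0, h1, ⟨q', h2⟩, h3, q, h4, h5⟩ := h
    have c0 : ∀ᶠ y in 𝓝 x, dist (p 0) y < D :=
      (show ContinuousAt (fun y => dist (p 0) y) x by fun_prop).eventually (gt_mem_nhds h0)
    have c3 : ∀ᶠ y in 𝓝 x, ∀ i : Fin k, Real.arccos
        (1 - (S + C) * dist (p (Fin.last k)) y / (2 * dist (p i.castSucc) y)) < δ := by
      refine eventually_all.2 fun i => ?_
      have := dist_pos.2 (hne i.castSucc)
      have hc : ContinuousAt (fun y => Real.arccos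
          (1 - (S + C) * dist (p (Fin.last k)) y / (2 * dist (p i.castSucc) y))) x :=
        Real.continuous_arccos.continuousAt.comp (continuousAt_const.sub
          (ContinuousAt.div (by fun_prop) (by fun_prop) (by positivity)))
      exact hc.eventually (gt_mem_nhds (h3 i))
    have c5 : ∀ᶠ y in 𝓝 x, ∀ i : Fin k,
        |comparisonAngle (p i.castSucc) y (p (Fin.last k)) - Real.pi / 2| < δ ∧
        |comparisonAngle (p i.castSucc) y q - Real.pi / 2| < δ := by
      refine eventually_all.2 fun i => Eventually.and ?_ ?_
      · exact ((continuousAt_comparisonAngle (hne _) (hne _)).sub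
          continuousAt_const).abs.eventually (gt_mem_nhds (h5 i).1)
      · exact ((continuousAt_comparisonAngle (hne _) h4.2.1).sub
          continuousAt_const).abs.eventually (gt_mem_nhds (h5 i).2)
    filter_upwards [c0, h1.eventually, h2.eventually, c3, h4.eventually, c5]
      with y g0 g1 g2 g3 g4 g5
    exact ⟨g0, g1, ⟨q', g2⟩, g3, q, g4, g5⟩

end Open

/-! ### Distance functions along geodesics -/

section Geodesic

variable {X : Type*} [MetricSpace X]

theorem IsConstSpeedGeodesic.dist_zero {γ : ℝ → X} (hγ : IsConstSpeedGeodesic γ) {t : ℝ}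
    (ht : t ∈ Icc (0 : ℝ) 1) : dist (γ 0) (γ t) = t * dist (γ 0) (γ 1) := by
  rw [hγ 0 (by simp) t ht, zero_sub, abs_neg, abs_of_nonneg ht.1]

theorem IsConstSpeedGeodesic.dist_one {γ : ℝ → X} (hγ : IsConstSpeedGeodesic γ) {t : ℝ}
    (ht : t ∈ Icc (0 : ℝ) 1) : dist (γ t) (γ 1) = (1 - t) * dist (γ 0) (γ 1) := by
  rw [hγ t ht 1 (by simp), abs_sub_comm, abs_of_nonneg (by linarith [ht.2])]

/-- The two convexity bounds control the squared distance against the square of the affine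
interpolation. Dividing by the sum of the two quantities, which is at least `a`, removes the
squares. -/
theorem abs_dist_sub_affine_le {S C D a : ℝ} (hS1 : 0 ≤ S) (hC0 : 0 ≤ C) (hS : IsSConcave X S)
    (hC : IsLocallySemiConvex X C D) {p : X} {γ : ℝ → X} (hγ : IsConstSpeedGeodesic γ)
    (hD : ∀ s ∈ Icc (0 : ℝ) 1, dist p (γ s) < D) (ha : 0 < a)
    (haγ : ∀ s ∈ Icc (0 : ℝ) 1, a ≤ dist p (γ s)) {t : ℝ} (ht : t ∈ Icc (0 : ℝ) 1) :
    |dist p (γ t) - ((1 - t) * dist p (γ 0) + t * dist p (γ 1))| ≤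
      (1 + C + S) / a * (t * (1 - t) * dist (γ 0) (γ 1) ^ 2) := by
  have h1 := hS p γ hγ t ht
  have h2 := hC p γ hγ hD t ht
  have hb := haγ t ht
  have h0 := haγ 0 (by simp)
  have h1' := haγ 1 (by simp)
  have h3 : (dist p (γ 1) - dist p (γ 0)) ^ 2 ≤ dist (γ 0) (γ 1) ^ 2 := by
    rw [sq_le_sq, abs_of_nonneg (dist_nonneg (x := γ 0))]
    simpa [dist_comm] using abs_dist_sub_le (γ 1) (γ 0) p
  set b := dist p (γ t)
  set u := dist p (γ 0)
  set v := dist p (γ 1)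
  set r := dist (γ 0) (γ 1)
  have ht' : 0 ≤ t * (1 - t) := mul_nonneg ht.1 (by linarith [ht.2])
  set m := (1 - t) * u + t * v with hm
  have hma : a ≤ m := by
    have := mul_le_mul_of_nonneg_left h0 (show 0 ≤ 1 - t by linarith [ht.2])
    have := mul_le_mul_of_nonneg_left h1' ht.1
    linarith
  have hm2 : m ^ 2 = (1 - t) * u ^ 2 + t * v ^ 2 - t * (1 - t) * (v - u) ^ 2 := by
    rw [hm]; ring
  set q := t * (1 - t) * r ^ 2 with hq
  have hq0 : 0 ≤ q := by positivity
  have h4 : t * (1 - t) * (v - u) ^ 2 ≤ q := mul_le_mul_of_nonneg_left h3 ht'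
  have h5 : 0 ≤ t * (1 - t) * (v - u) ^ 2 := by positivity
  have h6 : C * t * (1 - t) * r ^ 2 = C * q := by rw [hq]; ring
  have h7 : S * t * (1 - t) * r ^ 2 = S * q := by rw [hq]; ring
  rw [h7] at h1
  rw [h6] at h2
  have hCq : 0 ≤ C * q := by positivity
  have hSq : 0 ≤ S * q := by positivity
  have h8 : |b ^ 2 - m ^ 2| ≤ (1 + C + S) * q := by
    rw [abs_le]
    constructor <;> nlinarith
  have h9 : |b - m| * a ≤ |b ^ 2 - m ^ 2| := by
    rw [sq_sub_sq, abs_mul, mul_comm, abs_of_nonneg (show 0 ≤ b + m by linarith)]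
    exact mul_le_mul_of_nonneg_right (by linarith) (abs_nonneg _)
  rw [div_mul_eq_mul_div, le_div_iff₀ ha]
  linarith

end Geodesic

/-! ### Almost orthogonal packings -/

section Packing

variable {X : Type*} [MetricSpace X]

/-- There are `m` points at distance `r` from `x`, pairwise `ε * r`-separated, whose directions
at `x` are almost orthogonal to those of all `p l`. -/
def HasOrthogonalPacking {k : ℕ} (p : Fin k → X) (c A ε : ℝ) (x : X) (r : ℝ) (m : ℕ) : Prop :=
  ∃ z : Fin m → X, (∀ i, dist x (z i) = r) ∧
    (∀ i l, |dist (p l) (z i) - dist (p l) x| ≤ (c - A * r) * r) ∧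
    ∀ i j, i ≠ j → ε * r ≤ dist (z i) (z j)

/-- The tolerance `(c - A * r) * r` is made for this: with `ρ = t * r`, the affine error `A * t * (1
- t) * r ^ 2` plus `t` times the old tolerance equals `(c - A * ρ) * ρ`. -/
theorem exists_homothetic_packing {S C D a c A ε : ℝ} (hS1 : 0 ≤ S) (hC0 : 0 ≤ C) (ha : 0 < a)
    (hA : (1 + C + S) / a ≤ A) (hG : IsGeodesicSpace X) (hS : IsSConcave X S)
    (hC : IsLocallySemiConvex X C D) (hB : IsBusemannConcave X) {k : ℕ} {p : Fin k → X} {x : X}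
    {r ρ : ℝ} (hloc : ∀ y, dist x y ≤ r → ∀ l, a ≤ dist (p l) y ∧ dist (p l) y < D)
    (hρ : 0 < ρ) (hρr : ρ ≤ r) {m : ℕ} {z : Fin m → X} (hz : ∀ i, dist x (z i) = r)
    (hzp : ∀ i l, |dist (p l) (z i) - dist (p l) x| ≤ (c - A * r) * r)
    (hzz : ∀ i j, i ≠ j → ε * r ≤ dist (z i) (z j)) :
    ∃ w : Fin m → X, (∀ i, dist x (w i) = ρ) ∧
      (∀ i l, |dist (p l) (w i) - dist (p l) x| ≤ (c - A * ρ) * ρ) ∧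
      (∀ i j, i ≠ j → ε * ρ ≤ dist (w i) (w j)) ∧ ∀ i, dist (w i) (z i) = r - ρ := by
  have hr : 0 < r := hρ.trans_le hρr
  set t := ρ / r with ht
  have htr : t * r = ρ := by rw [ht]; field_simp
  have ht0 : 0 < t := by positivity
  have ht1 : t ≤ 1 := by rw [ht, div_le_one hr]; exact hρr
  have htI : t ∈ Icc (0 : ℝ) 1 := ⟨ht0.le, ht1⟩
  choose γ hγ hγ0 hγ1 using fun i => hG x (z i)
  have hlen : ∀ i, dist (γ i 0) (γ i 1) = r := fun i => by rw [hγ0, hγ1, hz]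
  have hd : ∀ i, ∀ s ∈ Icc (0 : ℝ) 1, dist x (γ i s) = s * r := fun i s hs => by
    have := (hγ i).dist_zero hs
    rwa [hlen, hγ0] at this
  have hl : ∀ i, ∀ s ∈ Icc (0 : ℝ) 1, ∀ l, a ≤ dist (p l) (γ i s) ∧ dist (p l) (γ i s) < D :=
    fun i s hs => hloc _ (by rw [hd i s hs]; nlinarith [hs.2])
  refine ⟨fun i => γ i t, fun i => ?_, fun i l => ?_, fun i j hij => ?_, fun i => ?_⟩
  · rw [hd i t htI, htr]
  · have h1 := abs_dist_sub_affine_le hS1 hC0 hS hC (hγ i) (fun s hs => (hl i s hs l).2) ha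
      (fun s hs => (hl i s hs l).1) htI
    rw [hlen, hγ0, hγ1] at h1
    have h2 := hzp i l
    have h3 : (1 + C + S) / a * (t * (1 - t) * r ^ 2) ≤ A * (t * (1 - t) * r ^ 2) :=
      mul_le_mul_of_nonneg_right hA (by
        have : 0 ≤ 1 - t := by linarith
        positivity)
    have h4 : dist (p l) (γ i t) - dist (p l) x =
        (dist (p l) (γ i t) - ((1 - t) * dist (p l) x + t * dist (p l) (z i))) +
          t * (dist (p l) (z i) - dist (p l) x) := by ring
    rw [h4]
    refine (abs_add_le _ _).trans ?_
    rw [abs_mul, abs_of_pos ht0]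
    have h5 := mul_le_mul_of_nonneg_left h2 ht0.le
    refine (add_le_add (h1.trans h3) h5).trans (le_of_eq ?_)
    rw [← htr]; ring
  · have := hB.le_dist (hγ i) (hγ j) (by rw [hγ0, hγ0]) ht0 ht1
    rw [hγ1, hγ1] at this
    refine le_trans ?_ this
    rw [← htr]
    nlinarith [hzz i j hij]
  · have := (hγ i).dist_one htI
    rw [hlen, hγ1] at this
    rw [this, ← htr]; ring

theorem abs_comparisonAngle_sub_pi_div_two_lt {p x y : X} {c δ : ℝ} (hδ : 0 < δ)
    (hδ' : δ < Real.pi / 2) (hp : p ≠ x) (hy : y ≠ x) (hc : c ≤ 1)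
    (h : |dist p y - dist p x| ≤ c * dist x y) (hs : c + dist x y / dist p x < Real.sin δ) :
    |comparisonAngle p x y - Real.pi / 2| < δ := by
  refine abs_arccos_sub_pi_div_two_lt hδ hδ' (lt_of_le_of_lt ?_ hs)
  have h1 : 0 < dist p x := dist_pos.2 hp
  have h2 : 0 < dist x y := dist_pos.2 hy.symm
  have h3 := abs_dist_sub_le y x p
  rw [dist_comm y p, dist_comm x p, dist_comm y x] at h3
  set u := dist p x
  set h' := dist x y
  set b := dist p y
  have hb : b ≤ u + h' := by linarith [(abs_le.1 h3).2]
  have hb0 : 0 ≤ b := dist_nonneg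
  rw [abs_div, abs_of_pos (show 0 < 2 * u * h' by positivity), div_le_iff₀ (by positivity)]
  have h4 : (c + h' / u) * (2 * u * h') = 2 * u * h' * c + 2 * h' ^ 2 := by field_simp
  rw [h4]
  have h5 : u ^ 2 + h' ^ 2 - b ^ 2 = h' ^ 2 - (b - u) * (b + u) := by ring
  have h6 : |(b - u) * (b + u)| ≤ c * h' * (2 * u + h') := by
    rw [abs_mul, abs_of_nonneg (show 0 ≤ b + u by linarith)]
    exact mul_le_mul h (by linarith) (by linarith) ((abs_nonneg _).trans h)
  rw [h5]
  refine (abs_sub _ _).trans ?_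
  rw [abs_of_nonneg (sq_nonneg h')]
  nlinarith

/-- If `x'` were closer to `w`, the path from `z` through `x'` to `x` would be almost as short as
`r`. Then `z` with opposite `x` would extend `p` to a strainer at `x'`. -/
theorem le_dist_of_notMem_strainedPoints {S C D δ a : ℝ} (hS1 : 1 ≤ S) (hC0 : 0 ≤ C)
    (hδ : 0 < δ) (hδ' : δ < 1 / 2) (ha : 0 < a) {k : ℕ} {p : Fin k → X} {x x' z w : X} {r ρ : ℝ}
    (hstr : IsStrainer S C D δ x' k p) (hx' : x' ∉ strainedPoints X S C D (k + 1) δ)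
    (hpa : ∀ l, a ≤ dist (p l) x') (hr1 : (S + C) * r < a * (1 - Real.cos δ))
    (hr2 : 4 * r < a * Real.sin δ) (hr3 : 2 * r < D) (hρ : 0 < ρ) (hρ1 : 2 * ρ ≤ r)
    (hρ2 : S * ρ < (1 - Real.cos δ) * r) (hxx' : dist x x' = ρ) (hxz : dist x z = r)
    (hzp : ∀ l, |dist (p l) z - dist (p l) x| ≤ Real.sin δ / 6 * r)
    (hx'p : ∀ l, |dist (p l) x' - dist (p l) x| ≤ Real.sin δ / 12 * ρ)
    (hwz : dist w z = r - ρ) : (1 - Real.cos δ) / 4 * ρ ≤ dist x' w := by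
  by_contra! hlt
  have hπ := Real.pi_gt_three
  have hsin : 0 < Real.sin δ := Real.sin_pos_of_pos_of_lt_pi hδ (by linarith)
  have hsin1 := Real.sin_le_one δ
  have hcos1 : Real.cos δ < 1 := by
    rw [← Real.cos_zero]
    exact Real.cos_lt_cos_of_nonneg_of_le_pi le_rfl (by linarith) hδ
  have hcos0 : 0 < Real.cos δ := Real.cos_pos_of_mem_Ioo ⟨by linarith, by linarith⟩
  set ε := (1 - Real.cos δ) / 4 with hε
  have hr : 0 < r := by linarith
  have hS0 : 0 ≤ S := by linarith
  have hSC : 0 ≤ S + C := by linarith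
  have hu1 : dist z x' ≤ r - ρ + ε * ρ := by
    have := dist_triangle_right z x' w
    rw [dist_comm z w] at this; linarith
  have hu2 : r - ρ ≤ dist z x' := by
    have := dist_triangle_left x z x'
    have := dist_triangle x x' z
    rw [dist_comm x' z] at this; linarith
  have hερ : ε * ρ ≤ ρ := by nlinarith
  have hx'x : x' ≠ x := fun h => by rw [h, dist_self] at hxx'; linarith
  have hzx' : z ≠ x' := fun h => by rw [h, dist_self] at hu2; linarith
  have hopp : IsOppositeStrainer S δ x' z x := by
    refine ⟨hzx', hx'x.symm, ?_, ?_⟩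
    · have hv : (dist z x' ^ 2 + dist x' x ^ 2 - dist z x ^ 2) / (2 * dist z x' * dist x' x) ≤
          -(1 - 2 * ε) := by
        rw [dist_comm x' x, dist_comm z x, hxx', hxz, div_le_iff₀ (by nlinarith)]
        have h1 : dist z x' + (1 - ε) * ρ ≤ r := by linarith
        have h0 : 0 ≤ dist z x' + (1 - ε) * ρ := by nlinarith
        have h2 : (dist z x' + (1 - ε) * ρ) ^ 2 ≤ r ^ 2 := pow_le_pow_left₀ h0 h1 2
        have h3 : ε * ρ * (dist z x' - ρ) ≥ 0 := by
          have : 0 ≤ dist z x' - ρ := by linarith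
          have : 0 ≤ ε := by rw [hε]; linarith
          positivity
        nlinarith [sq_nonneg (ε * ρ)]
      have h1 : Real.arccos (1 - 2 * ε) < δ := by
        rw [arccos_lt_iff_cos_lt hδ (by linarith)]; linarith
      have h2 := Real.antitone_arccos hv
      rw [Real.arccos_neg] at h2
      unfold comparisonAngle
      linarith
    · rw [arccos_lt_iff_cos_lt hδ (by linarith), hxx']
      have : S * (ρ / (2 * dist z x')) ≤ S * ρ / r := by
        rw [mul_div_assoc]
        gcongr
        linarith
      have h2 : S * ρ / r < 1 - Real.cos δ := by rwa [div_lt_iff₀ (by linarith)]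
      linarith
  have hu3 : dist z x' ≤ 2 * r := by linarith
  apply hx'
  refine ⟨Fin.snoc p z, ?_, ?_, ?_, ?_, x, ?_⟩
  · rcases k with _ | k
    · have : (Fin.snoc p z : Fin 1 → X) 0 = z := by simp [Fin.snoc]
      rw [this]; linarith
    · have : (Fin.snoc p z : Fin (k + 1 + 1) → X) 0 = p 0 := by
        rw [← Fin.castSucc_zero, Fin.snoc_castSucc]
      rw [this]; exact hstr.1
  · simpa using hstr
  · simpa using ⟨x, hopp⟩
  · intro i
    simp only [Fin.snoc_castSucc, Fin.snoc_last]
    rw [arccos_lt_iff_cos_lt hδ (by linarith)]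
    have h1 : (S + C) * dist z x' / (2 * dist (p i) x') ≤ (S + C) * (2 * r) / (2 * a) := by
      have := hpa i
      gcongr
    have h2 : (S + C) * (2 * r) / (2 * a) < 1 - Real.cos δ := by
      rw [div_lt_iff₀ (by positivity)]; linarith
    linarith
  · simp only [Fin.snoc_castSucc, Fin.snoc_last]
    refine ⟨hopp, fun i => ⟨?_, ?_⟩⟩
    · refine abs_comparisonAngle_sub_pi_div_two_lt (c := Real.sin δ / 2) hδ (by linarith)
        (hstr.ne i) hzx' (by linarith) ?_ ?_
      · have h1 := hzp i
        have h2 := hx'p i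
        rw [abs_le] at h1 h2 ⊢
        rw [dist_comm x' z]
        have h3 : Real.sin δ * (r / 2) ≤ Real.sin δ * dist z x' := by gcongr; linarith
        have h4 : Real.sin δ * ρ ≤ Real.sin δ * (r / 2) := by gcongr; linarith
        constructor <;> linarith
      · have h1 : dist x' z / dist (p i) x' ≤ 2 * r / a := by
          rw [dist_comm x' z]
          gcongr
          exact hpa i
        have h2 : 2 * r / a < Real.sin δ / 2 := by rw [div_lt_iff₀ ha]; linarith
        linarith
    · refine abs_comparisonAngle_sub_pi_div_two_lt (c := Real.sin δ / 2) hδ (by linarith)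
        (hstr.ne i) hx'x.symm (by linarith) ?_ ?_
      · have h2 := hx'p i
        rw [abs_sub_comm, dist_comm x' x, hxx']
        have : 0 < Real.sin δ * ρ := by positivity
        linarith
      · have h1 : dist x' x / dist (p i) x' ≤ 2 * r / a := by
          rw [dist_comm x' x, hxx']
          gcongr
          · linarith
          · exact hpa i
        have h2 : 2 * r / a < Real.sin δ / 2 := by rw [div_lt_iff₀ ha]; linarith
        linarith

end Packing

/-! ### Dimension of the layers -/

section Dimension

variable {X : Type*} [MetricSpace X]

theorem HasOrthogonalPacking.succ {S C D δ a A : ℝ} (hS1 : 1 ≤ S) (hC0 : 0 ≤ C)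
    (hδ : 0 < δ) (hδ' : δ < 1 / 2) (ha : 0 < a) (hA : (1 + C + S) / a ≤ A)
    (hG : IsGeodesicSpace X) (hS : IsSConcave X S) (hC : IsLocallySemiConvex X C D)
    (hB : IsBusemannConcave X) {k : ℕ} {p : Fin k → X} {x x' : X} {r : ℝ}
    (hloc : ∀ y, dist x y ≤ r → ∀ l, a ≤ dist (p l) y ∧ dist (p l) y < D)
    (hr1 : (S + C) * r < a * (1 - Real.cos δ)) (hr2 : 4 * r < a * Real.sin δ) (hr3 : 2 * r < D)
    (hr4 : A * r ≤ Real.sin δ / 12) (hstr : IsStrainer S C D δ x' k p)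
    (hx' : x' ∉ strainedPoints X S C D (k + 1) δ) (hne : x ≠ x') (hρ1 : 2 * dist x x' ≤ r)
    (hρ2 : S * dist x x' < (1 - Real.cos δ) * r)
    (hx'p : ∀ l, |dist (p l) x' - dist (p l) x| ≤ Real.sin δ / 12 * dist x x') {m : ℕ}
    (h : HasOrthogonalPacking p (Real.sin δ / 6) A ((1 - Real.cos δ) / 4) x r m) :
    HasOrthogonalPacking p (Real.sin δ / 6) A ((1 - Real.cos δ) / 4) x (dist x x') (m + 1) := by
  obtain ⟨z, hz, hzp, hzz⟩ := h
  have hρ : 0 < dist x x' := dist_pos.2 hne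
  set ρ := dist x x' with hρdef
  have hA0 : 0 ≤ A := le_trans (by positivity) hA
  obtain ⟨w, hw, hwp, hww, hwz⟩ := exists_homothetic_packing (by linarith) hC0 ha hA hG hS hC hB
    hloc hρ (by linarith) hz hzp hzz
  have hx'w : ∀ i, (1 - Real.cos δ) / 4 * ρ ≤ dist x' (w i) := fun i => by
    refine le_dist_of_notMem_strainedPoints hS1 hC0 hδ hδ' ha hstr hx'
      (fun l => (hloc x' (by linarith) l).1) hr1 hr2 hr3 hρ hρ1 hρ2 hρdef.symm (hz i) (fun l => ?_)
      hx'p (hwz i)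
    refine (hzp i l).trans ?_
    have : 0 ≤ A * r * r := by
      have : 0 < r := by linarith
      positivity
    linarith
  refine ⟨Fin.cons x' w, fun i => ?_, fun i l => ?_, fun i j => ?_⟩
  · refine Fin.cases ?_ (fun i => ?_) i
    · simp [hρdef]
    · simpa using hw i
  · refine Fin.cases ?_ (fun i => ?_) i
    · simp only [Fin.cons_zero]
      refine (hx'p l).trans ?_
      -- Since `A * r ≤ sin δ / 12`, the tolerance `sin δ / 6 - A * ρ` leaves at least the `sin δ /
      -- 12` needed for `x'`.
      have : A * ρ ≤ A * r := by gcongr; linarith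
      gcongr
      linarith
    · simpa using hwp i l
  · refine Fin.cases ?_ (fun i => ?_) i <;> refine Fin.cases ?_ (fun j => ?_) j
    · simp
    · intro _; simpa using hx'w j
    · intro _; simpa [dist_comm] using hx'w i
    · intro hij; simpa using hww i j (by simpa using hij)

theorem exists_nhds_dimH_diff_strainedPoints_le [CompleteSpace X] [SecondCountableTopology X]
    {S C D δ : ℝ} (hS1 : 1 ≤ S) (hC0 : 0 ≤ C) (hD : 0 < D) (hδ : 0 < δ) (hδ' : δ < 1 / 2)
    (hG : IsGeodesicSpace X) (hS : IsSConcave X S) (hC : IsLocallySemiConvex X C D)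
    (hB : IsBusemannConcave X) {n : ℕ} (hn : dimH (univ : Set X) = (n : ℝ≥0∞)) {k : ℕ}
    {p : Fin k → X} {x₀ : X} (hp : IsStrainer S C D δ x₀ k p) :
    ∃ t ∈ 𝓝 x₀, dimH (t \ strainedPoints X S C D (k + 1) δ) ≤ (k : ℝ≥0∞) := by
  have hπ := Real.pi_gt_three
  have hsin : 0 < Real.sin δ := Real.sin_pos_of_pos_of_lt_pi hδ (by linarith)
  have hcos1 : Real.cos δ < 1 := by
    rw [← Real.cos_zero]
    exact Real.cos_lt_cos_of_nonneg_of_le_pi le_rfl (by linarith) hδ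
  have hcos0 : 0 < Real.cos δ := Real.cos_pos_of_mem_Ioo ⟨by linarith, by linarith⟩
  have hcos : 0 < 1 - Real.cos δ := by linarith
  obtain ⟨a, ha, hap⟩ : ∃ a : ℝ, 0 < a ∧ ∀ l, a < dist (p l) x₀ := by
    have h1 : ∀ᶠ a : ℝ in 𝓝[>] 0, ∀ l, a < dist (p l) x₀ :=
      eventually_all.2 fun l =>
        nhdsWithin_le_nhds (gt_mem_nhds (dist_pos.2 (hp.ne l)))
    obtain ⟨a, h2, h3⟩ := (h1.and self_mem_nhdsWithin).exists
    exact ⟨a, h3, h2⟩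
  have hev : ∀ᶠ y in 𝓝 x₀, IsStrainer S C D δ y k p ∧
      ∀ l, a ≤ dist (p l) y ∧ dist (p l) y < D := by
    refine hp.eventually.and (eventually_all.2 fun l => ?_)
    have hc : ContinuousAt (fun y => dist (p l) y) x₀ := by fun_prop
    filter_upwards [hc.eventually (lt_mem_nhds (hap l)),
      hc.eventually (gt_mem_nhds (hp.dist_lt hS1 hC0 hδ hδ' l))] with y h1 h2
    exact ⟨h1.le, h2⟩
  obtain ⟨R, hR, hball⟩ := Metric.eventually_nhds_iff.1 hev
  set A := (1 + C + S) / a with hA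
  have hA0 : 0 < A := by positivity
  have hSC : 0 < S + C := by linarith
  obtain ⟨r₀, hr₀, hr₀R, hr1, hr2, hr3, hr4⟩ : ∃ r₀ : ℝ, 0 < r₀ ∧ 2 * r₀ < R ∧
      (S + C) * r₀ < a * (1 - Real.cos δ) ∧ 4 * r₀ < a * Real.sin δ ∧ 2 * r₀ < D ∧
      A * r₀ < Real.sin δ / 12 := by
    have hlin : ∀ b c : ℝ, 0 < c → ∀ᶠ r in 𝓝[>] (0 : ℝ), b * r < c := fun b c hc => by
      refine nhdsWithin_le_nhds ?_
      have : ContinuousAt (fun r : ℝ => b * r) 0 := by fun_prop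
      exact this.eventually (gt_mem_nhds (by simpa using hc))
    obtain ⟨r, h⟩ := ((hlin 2 R hR).and <| (hlin (S + C) (a * (1 - Real.cos δ)) (by positivity)).and
      <| (hlin 4 (a * Real.sin δ) (by positivity)).and <| (hlin 2 D hD).and <|
      (hlin A (Real.sin δ / 12) (by positivity)).and self_mem_nhdsWithin).exists
    exact ⟨r, h.2.2.2.2.2, h.1, h.2.1, h.2.2.1, h.2.2.2.1, h.2.2.2.2.1⟩
  set ε := (1 - Real.cos δ) / 4 with hε
  have hε0 : 0 < ε := by positivity
  obtain ⟨M, hM⟩ := exists_packing_bound hG hB hn hε0 (by linarith)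
  set P := HasOrthogonalPacking p (Real.sin δ / 6) A ε with hP
  set s : ℕ → ℝ := fun j => r₀ / (j + 1) with hs
  have hs0 : ∀ j, 0 < s j := fun j => by positivity
  have hsr : ∀ j, s j ≤ r₀ := fun j => div_le_self hr₀.le (by linarith [Nat.cast_nonneg (α := ℝ) j])
  have hloc : ∀ x ∈ Metric.ball x₀ r₀, ∀ y, dist x y ≤ r₀ →
      ∀ l, a ≤ dist (p l) y ∧ dist (p l) y < D := by
    intro x hx y hxy
    refine (hball ?_).2
    have := dist_triangle_left y x₀ x
    rw [Metric.mem_ball] at hx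
    linarith
  have hstr : ∀ x ∈ Metric.ball x₀ r₀, IsStrainer S C D δ x k p := fun x hx =>
    (hball (by rw [Metric.mem_ball] at hx; linarith)).1
  -- In `E (j, m)`, size `m` is attained at scale `s j` and cannot be exceeded at smaller scales.
  -- The discrete scales make the decomposition countable.
  set E : ℕ × ℕ → Set X := fun jm => {x | x ∈ Metric.ball x₀ r₀ ∧
    x ∉ strainedPoints X S C D (k + 1) δ ∧ P x (s jm.1) jm.2 ∧
      ∀ r, 0 < r → r ≤ s jm.1 → ¬ P x r (jm.2 + 1)} with hE
  have hcover : Metric.ball x₀ r₀ \ strainedPoints X S C D (k + 1) δ ⊆ ⋃ jm, E jm := by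
    classical
    rintro x ⟨hx, hxs⟩
    have hex : ∃ m, ¬ ∃ r, 0 < r ∧ r ≤ r₀ ∧ P x r m := by
      refine ⟨M, ?_⟩
      rintro ⟨r, hr, -, z, hz, -, hzz⟩
      obtain ⟨i, j, hij, hlt⟩ := hM x r hr z fun i => (hz i).le
      linarith [hzz i j hij]
    obtain ⟨m, hm⟩ : ∃ m, Nat.find hex = m + 1 := by
      refine Nat.exists_eq_succ_of_ne_zero fun h0 => ?_
      have := Nat.find_spec hex
      rw [h0] at this
      exact this ⟨r₀, hr₀, le_rfl, fun i => i.elim0, fun i => i.elim0, fun i => i.elim0,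
        fun i => i.elim0⟩
    have hnot := Nat.find_spec hex
    rw [hm] at hnot
    have hyes := Nat.find_min hex (m := m) (by omega)
    push Not at hnot hyes
    obtain ⟨r, hr, hrr, z, hz, hzp, hzz⟩ := hyes
    obtain ⟨j, hj⟩ := exists_nat_ge (r₀ / r)
    have hjr : s j ≤ r := by
      rw [div_le_iff₀ hr] at hj
      simp only [hs]
      rw [div_le_iff₀ (by positivity)]
      nlinarith
    obtain ⟨w, hw, hwp, hww, -⟩ := exists_homothetic_packing (by linarith) hC0 ha le_rfl hG hS hC
      hB (fun y hy => hloc x hx y (by linarith)) (hs0 j) hjr hz hzp hzz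
    exact mem_iUnion.2 ⟨(j, m), hx, hxs, ⟨w, hw, hwp, hww⟩,
      fun r hr hrj => hnot r hr (hrj.trans (hsr j))⟩
  refine ⟨Metric.ball x₀ r₀, Metric.ball_mem_nhds _ hr₀, (dimH_mono hcover).trans ?_⟩
  rw [dimH_iUnion]
  refine iSup_le fun jm => ?_
  by_contra! hlt
  obtain ⟨x₁, -, hx₁⟩ := exists_mem_nhdsWithin_lt_dimH_of_lt_dimH hlt
  set r := s jm.1 with hr
  have hr0 : 0 < r := hs0 _
  have hrr : r ≤ r₀ := hsr _
  -- Two points of a `κ`-ball satisfy `S * dist x x' < (1 - cos δ) * r / 2`, which gives both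
  -- smallness conditions of `HasOrthogonalPacking.succ`.
  set κ := (1 - Real.cos δ) * r / (4 * S) with hκ
  have hκ0 : 0 < κ := by positivity
  have hκS : 4 * S * κ = (1 - Real.cos δ) * r := by rw [hκ]; field_simp
  refine (hx₁ (E jm ∩ Metric.ball x₁ κ) (inter_mem_nhdsWithin _ (Metric.ball_mem_nhds _ hκ0))).not_ge
    ?_
  refine (dimH_le_of_antilipschitzOn (f := fun y (l : Fin k) => dist (p l) y)
    (K := 12 / Real.sin δ) (by positivity) ?_).trans
    ((dimH_mono (subset_univ _)).trans (Real.dimH_univ_pi_fin k).le)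
  rintro x ⟨⟨hx, -, hxP, hxN⟩, hxκ⟩ x' ⟨⟨hx', hx's, -, -⟩, hx'κ⟩
  by_contra! hcon
  have hdκ : dist x x' < 2 * κ := by
    have := dist_triangle_right x x' x₁
    rw [Metric.mem_ball] at hxκ hx'κ
    linarith
  have hne : x ≠ x' := by
    rintro rfl
    simp at hcon
  have hSd : S * dist x x' < S * (2 * κ) := by gcongr
  have hdS : dist x x' ≤ S * dist x x' := le_mul_of_one_le_left dist_nonneg hS1
  have hcr : (1 - Real.cos δ) * r ≤ r := by nlinarith
  have hcr0 : 0 < (1 - Real.cos δ) * r := by positivity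
  refine hxN (dist x x') (dist_pos.2 hne) (by linarith) ?_
  refine HasOrthogonalPacking.succ hS1 hC0 hδ hδ' ha le_rfl hG hS hC hB
    (fun y hy => hloc x hx y (hy.trans hrr)) ?_ (by linarith) (by linarith) ?_ (hstr x' hx')
    hx's hne (by linarith) (by linarith) (fun l => ?_) hxP
  · exact lt_of_le_of_lt (by gcongr) hr1
  · exact le_trans (by gcongr) hr4.le
  · have h1 := dist_le_pi_dist (fun l : Fin k => dist (p l) x) (fun l => dist (p l) x') l
    rw [dist_comm, Real.dist_eq] at h1
    rw [div_mul_eq_mul_div, div_lt_iff₀ hsin] at hcon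
    linarith

theorem dimH_strainedPoints_diff_succ_le [CompleteSpace X] [SecondCountableTopology X]
    {S C D δ : ℝ} (hS1 : 1 ≤ S) (hC0 : 0 ≤ C) (hD : 0 < D) (hδ : 0 < δ) (hδ' : δ < 1 / 2)
    (hG : IsGeodesicSpace X) (hS : IsSConcave X S) (hC : IsLocallySemiConvex X C D)
    (hB : IsBusemannConcave X) {n : ℕ} (hn : dimH (univ : Set X) = (n : ℝ≥0∞)) (k : ℕ) :
    dimH (strainedPoints X S C D k δ \ strainedPoints X S C D (k + 1) δ) ≤ (k : ℝ≥0∞) := by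
  by_contra! hlt
  obtain ⟨x₀, ⟨⟨p, hp⟩, -⟩, hx₀⟩ := exists_mem_nhdsWithin_lt_dimH_of_lt_dimH hlt
  obtain ⟨t, ht, htk⟩ :=
    exists_nhds_dimH_diff_strainedPoints_le hS1 hC0 hD hδ hδ' hG hS hC hB hn hp
  refine (hx₀ _ (inter_mem_nhdsWithin _ ht)).not_ge ((dimH_mono ?_).trans htk)
  rintro x ⟨⟨-, hx⟩, hxt⟩
  exact ⟨hxt, hx⟩

theorem dimH_diff_strainedPoints_succ_le [CompleteSpace X] [SecondCountableTopology X]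
    {S C D δ : ℝ} (hS1 : 1 ≤ S) (hC0 : 0 ≤ C) (hD : 0 < D) (hδ : 0 < δ) (hδ' : δ < 1 / 2)
    (hG : IsGeodesicSpace X) (hS : IsSConcave X S) (hC : IsLocallySemiConvex X C D)
    (hB : IsBusemannConcave X) {n : ℕ} (hn : dimH (univ : Set X) = (n : ℝ≥0∞)) (k : ℕ) :
    dimH (univ \ strainedPoints X S C D (k + 1) δ) ≤ (k : ℝ≥0∞) := by
  have hstep := dimH_strainedPoints_diff_succ_le hS1 hC0 hD hδ hδ' hG hS hC hB hn
  induction k with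
  | zero =>
    refine (dimH_mono ?_).trans (hstep 0)
    rintro x ⟨-, hx⟩
    exact ⟨⟨fun i => i.elim0, trivial⟩, hx⟩
  | succ k ih =>
    have hsub : univ \ strainedPoints X S C D (k + 1 + 1) δ ⊆
        (univ \ strainedPoints X S C D (k + 1) δ) ∪
          (strainedPoints X S C D (k + 1) δ \ strainedPoints X S C D (k + 1 + 1) δ) := by
      rintro x ⟨-, hx⟩
      by_cases h : x ∈ strainedPoints X S C D (k + 1) δ
      · exact Or.inr ⟨h, hx⟩
      · exact Or.inl ⟨mem_univ x, h⟩
    refine (dimH_mono hsub).trans ?_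
    rw [dimH_union]
    exact max_le (ih.trans (by exact_mod_cast k.le_succ)) (hstep (k + 1))

end Dimension

end StrainerTheory

theorem mainTheorem7 (δ : ℝ) (hδ_pos : 0 < δ) (hδ_lt : δ < 1 / 2) :
    ∃ S₁ : ℝ, 1 < S₁ ∧
      ∀ (X : Type*) [MetricSpace X] [CompleteSpace X] (S C D : ℝ) (n : ℕ),
        1 ≤ S → S ≤ S₁ → 0 ≤ C → 0 < D →
        StrainerTheory.IsGeodesicSpace X →
        StrainerTheory.IsSConcave X S →
        StrainerTheory.IsLocallySemiConvex X C D →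
        StrainerTheory.IsBusemannConcave X →
        dimH (univ : Set X) = (n : ℝ≥0∞) →
        ∀ k : ℕ, 1 ≤ k → k ≤ n →
          dimH (univ \ StrainerTheory.strainedPoints X S C D k δ) ≤ ((k - 1 : ℕ) : ℝ≥0∞) := by
  -- The argument works for every `S ≥ 1`, so the value 2 is arbitrary.
  refine ⟨2, one_lt_two, ?_⟩
  intro X _ _ S C D n hS1 _ hC0 hD hG hS hC hB hn k hk _
  have : SecondCountableTopology X := StrainerTheory.secondCountable_of_packing_bound
    fun ε hε hε1 => StrainerTheory.exists_packing_bound hG hB hn hε hε1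
  obtain ⟨k, rfl⟩ := Nat.exists_eq_add_of_le' hk
  simpa using StrainerTheory.dimH_diff_strainedPoints_succ_le hS1 hC0 hD hδ_pos hδ_lt
    hG hS hC hB hn k
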